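/- Let $m=p=2$. A (strictly proper) linear system with 2 inputs and 2 outputs over $\mathbb C$ is given by a state-space realization $\Sigma=(A,B,C)$, $\dot x=Ax+Bu$, $y=Cx$, with complex matrices of sizes $N\times N$, $N\times 2$, $2\times N$; two realizations (possibly with different $N$) represent the same system if their transfer functions $G(s)=C(sI-A)^{-1}B$ are equal as matrices of rational functions. Let $X\subset\bigwedge^2\mathbb C^4$ be the linear span of the Plücker vectors of the points of the Hermann–Martin curve, which sends $s\in\mathbb P^1$ to the column space of $\binom{I_2}{G(s)}$, and let $Z\subset\bigwedge^2\mathbb C^4$ be its annihilator under the wedge pairing $\bigwedge^2\mathbb C^4\times\bigwedge^2\mathbb C^4\to\bigwedge^4\mathbb C^4\cong\mathbb C$. The pole placement map $K\mapsto\det(sI-(A+BKC))$ is the linear projection of the Grassmannian $\mathrm{Gr}_2\mathbb C^4$ with center $\mathbb PZ$; it is called proper if $\mathbb PZ$ is nonempty and disjoint from $\mathrm{Gr}_2\mathbb C^4$. A realization $(A,B,C)$ is symmetric if $A^T=A$ and $C=B^T$. Two realizations $(A,B,C)$ and $(\widetilde A,\widetilde B,\widetilde C)$ of the same state dimension are state-feedback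 equivalent if there are invertible matrices $R,W,T$ and a matrix $Q$ with \[ \widetilde A=R^{-1}(A+BQT^{-1}C)R,\qquad \widetilde B=R^{-1}BW,\qquad \widetilde C=T^{-1}CR . \] Corollary 2.3. If a linear system with $m=p=2$ that is given by a controllable and observable state-space realization has a proper pole placement map, then every controllable and observable state-space realization of this system is state-feedback equivalent to a symmetric realization. -/

import Mathlib

open scoped Matrix

/-- A state-space realization `(A, B, C)` with state space `ℂ^N` of a strictly proper
`m`-input, `p`-output linear system `ẋ = A x + B u`, `y = C x`. -/
structure StateSpaceRealization (N m p : ℕ) where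
  A : Matrix (Fin N) (Fin N) ℂ
  B : Matrix (Fin N) (Fin m) ℂ
  C : Matrix (Fin p) (Fin N) ℂ

namespace StateSpaceRealization

variable {N N' m p : ℕ}

/-- Kalman's rank condition: the columns of `B, A B, …, A^(N-1) B` span `ℂ^N`. -/
def Controllable (S : StateSpaceRealization N m p) : Prop :=
  ⨆ k : Fin N, LinearMap.range (S.A ^ (k : ℕ) * S.B).mulVecLin = ⊤

/-- Kalman's rank condition: `C, C A, …, C A^(N-1)` have no common kernel. -/
def Observable (S : StateSpaceRealization N m p) : Prop :=
  ⨅ k : Fin N, LinearMap.ker (S.C * S.A ^ (k : ℕ)).mulVecLin = ⊥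

/-- `s ∈ ℂ` is an eigenvalue of `A`. -/
def IsEigenvalue (S : StateSpaceRealization N m p) (s : ℂ) : Prop :=
  (s • (1 : Matrix (Fin N) (Fin N) ℂ) - S.A).det = 0

/-- The transfer function `G(s) = C (s I - A)⁻¹ B`, meaningful when `s` is not an eigenvalue
of `A`. -/
noncomputable def transferFunction (S : StateSpaceRealization N m p) (s : ℂ) :
    Matrix (Fin p) (Fin m) ℂ :=
  S.C * (s • (1 : Matrix (Fin N) (Fin N) ℂ) - S.A)⁻¹ * S.B

/-- Two realizations, possibly of different state dimensions, realize the same linear system: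
their transfer functions are equal as matrices of rational functions, that is, they agree at
every point which is an eigenvalue of neither state matrix. -/
def SameSystem (S : StateSpaceRealization N m p) (S' : StateSpaceRealization N' m p) : Prop :=
  ∀ s : ℂ, ¬ S.IsEigenvalue s → ¬ S'.IsEigenvalue s →
    S.transferFunction s = S'.transferFunction s

end StateSpaceRealization

/-- The Plücker vector in `⋀^m ℂ^(m+p)` of the column space of the `(m+p) × m` matrix with
upper block `I_m` and lower block `G`, i.e. the wedge product of the columns. -/
noncomputable def pluckerGraph {m p : ℕ} (G : Matrix (Fin p) (Fin m) ℂ) :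
    ⋀[ℂ]^m (Fin m ⊕ Fin p → ℂ) :=
  exteriorPower.ιMulti ℂ m
    (fun j => (Matrix.fromRows (1 : Matrix (Fin m) (Fin m) ℂ) G).col j)

namespace StateSpaceRealization

variable {N m p : ℕ}

/-- The linear span `X ⊆ ⋀^m ℂ^(m+p)` of the Hermann–Martin curve, the curve in the Grassmannian
that sends `s ∈ ℙ¹` to the column space of `(I; G(s))`. The point `s = ∞` gives `(I; 0)`, because
`G` is strictly proper. At the finitely many eigenvalues of `A` the curve is defined by continuity;
these limits lie in the (closed) span of the other points, so they need not be listed. -/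
noncomputable def curveSpan (S : StateSpaceRealization N m p) :
    Submodule ℂ (⋀[ℂ]^m (Fin m ⊕ Fin p → ℂ)) :=
  Submodule.span ℂ
    (insert (pluckerGraph 0) {x | ∃ s : ℂ, ¬ S.IsEigenvalue s ∧
      x = pluckerGraph (S.transferFunction s)})

/-- The center `Z ⊆ ⋀^p ℂ^(m+p)` of the pole placement map viewed as a linear projection of the
Grassmannian: the annihilator of `X` under the perfect pairing
`⋀^m ℂ^(m+p) × ⋀^p ℂ^(m+p) → ⋀^(m+p) ℂ^(m+p) ≅ ℂ` given by the wedge product, which is the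
product of the exterior algebra. -/
noncomputable def center (S : StateSpaceRealization N m p) :
    Submodule ℂ (⋀[ℂ]^p (Fin m ⊕ Fin p → ℂ)) where
  carrier := {w | ∀ x ∈ S.curveSpan,
    (x : ExteriorAlgebra ℂ (Fin m ⊕ Fin p → ℂ)) * (w : ExteriorAlgebra ℂ (Fin m ⊕ Fin p → ℂ)) = 0}
  add_mem' := by
    intro a b ha hb x hx
    rw [Submodule.coe_add, mul_add, ha x hx, hb x hx, add_zero]
  zero_mem' := by
    intro x _
    rw [Submodule.coe_zero, mul_zero]
  smul_mem' := by
    intro c a ha x hx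
    rw [Submodule.coe_smul, mul_smul_comm, ha x hx, smul_zero]

/-- The pole placement map is proper: `ℙ Z` is nonempty and disjoint from the Grassmannian
`Gr_p ℂ^(m+p)`, whose points are the classes of the wedge products of `p` linearly independent
vectors. -/
def ProperPolePlacement (S : StateSpaceRealization N m p) : Prop :=
  S.center ≠ ⊥ ∧
    ∀ v : Fin p → (Fin m ⊕ Fin p → ℂ), LinearIndependent ℂ v →
      exteriorPower.ιMulti ℂ p v ∉ S.center

/-- `S'` is obtained from `S` by the state-feedback transformation `x = R x'`, `u = Q y' + W u'`,
`y = T y'`, with `R`, `W`, `T` invertible and `Q` arbitrary. This relation is symmetric; see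
`StateFeedbackEquivalent.symm`. -/
def StateFeedbackEquivalent (S S' : StateSpaceRealization N m p) : Prop :=
  ∃ (R : GL (Fin N) ℂ) (W : GL (Fin m) ℂ) (T : GL (Fin p) ℂ) (Q : Matrix (Fin m) (Fin p) ℂ),
    S'.A = (R⁻¹).val * (S.A + S.B * Q * (T⁻¹).val * S.C) * R.val ∧
    S'.B = (R⁻¹).val * S.B * W.val ∧
    S'.C = (T⁻¹).val * S.C * R.val

theorem StateFeedbackEquivalent.symm {S S' : StateSpaceRealization N m p}
    (h : S.StateFeedbackEquivalent S') : S'.StateFeedbackEquivalent S := by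
  obtain ⟨R, W, T, Q, hA, hB, hC⟩ := h
  refine ⟨R⁻¹, W⁻¹, T⁻¹, -((W⁻¹).val * Q * (T⁻¹).val), ?_, ?_, ?_⟩
  · have h1 : R.val * (R⁻¹).val = 1 := R.mul_inv
    have h2 : W.val * (W⁻¹).val = 1 := W.mul_inv
    have h3 : T.val * (T⁻¹).val = 1 := T.mul_inv
    have h4 : (T⁻¹).val * T.val = 1 := T.inv_mul
    have key : S'.A + S'.B * -((W⁻¹).val * Q * (T⁻¹).val) * T.val * S'.C
        = (R⁻¹).val * S.A * R.val := by
      rw [hA, hB, hC]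
      have : (R⁻¹).val * S.B * W.val * -((W⁻¹).val * Q * (T⁻¹).val) * T.val *
          ((T⁻¹).val * S.C * R.val)
          = -((R⁻¹).val * S.B * (W.val * (W⁻¹).val) * Q * ((T⁻¹).val * T.val) * (T⁻¹).val
            * S.C * R.val) := by
        simp only [Matrix.mul_assoc, Matrix.mul_neg, Matrix.neg_mul]
      rw [this, h2, h4]
      simp only [Matrix.mul_add, Matrix.add_mul, Matrix.mul_one, Matrix.mul_assoc]
      abel
    rw [inv_inv, inv_inv, key]
    rw [show R.val * ((R⁻¹).val * S.A * R.val) * (R⁻¹).val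
      = (R.val * (R⁻¹).val) * S.A * (R.val * (R⁻¹).val) by simp only [Matrix.mul_assoc], h1]
    simp
  · have h1 : R.val * (R⁻¹).val = 1 := R.mul_inv
    have h2 : W.val * (W⁻¹).val = 1 := W.mul_inv
    rw [inv_inv, hB, show R.val * ((R⁻¹).val * S.B * W.val) * (W⁻¹).val
      = (R.val * (R⁻¹).val) * S.B * (W.val * (W⁻¹).val) by simp only [Matrix.mul_assoc], h1, h2]
    simp
  · have h1 : R.val * (R⁻¹).val = 1 := R.mul_inv
    have h3 : T.val * (T⁻¹).val = 1 := T.mul_inv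
    rw [inv_inv, hC, show T.val * ((T⁻¹).val * S.C * R.val) * (R⁻¹).val
      = (T.val * (T⁻¹).val) * S.C * (R.val * (R⁻¹).val) by simp only [Matrix.mul_assoc], h1, h3]
    simp

/-- `Aᵀ = A` and `C = Bᵀ`. -/
def IsSymmetric (S : StateSpaceRealization N m m) : Prop :=
  S.Aᵀ = S.A ∧ S.C = S.Bᵀ

end StateSpaceRealization

/-! A nonzero `z` in the center turns the span condition into one relation `tr (L G) + a det G = 0`.
The point at infinity kills the constant term, and since `z` lies off the Klein quadric, `det L ≠ 0`
(`ProperPolePlacement.exists_trace_relation`). Output feedback replaces `G` by `G' = G (1 - K G)⁻¹`.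
A suitable multiple `K` of `L` removes the quadratic term, leaving `tr (L G') = 0`
(`trace_mul_feedback_eq_zero`). If `J` is the standard skew matrix and `J T⁻¹ = L`, this says that
`T⁻¹ G'` is symmetric. Feedback and output changes preserve controllability and observability. A
controllable and observable realization with symmetric Markov parameters is similar to its transpose
through a symmetric `P`; writing `P = Mᵀ M` over `ℂ` and changing basis by `M` makes it symmetric
(`exists_symmetric_similarity`). -/

/-! ### Symmetric matrices: factorization and construction -/

/-- A symmetric invertible complex matrix factors as `Mᵀ * M`. -/
theorem Matrix.IsSymm.exists_transpose_mul_self {n : Type*} [Fintype n] [DecidableEq n]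
    {P : Matrix n n ℂ} (hP : P.IsSymm) (hdet : P.det ≠ 0) :
    ∃ M : Matrix n n ℂ, Mᵀ * M = P := by
  -- A symmetric matrix is recovered from its quadratic form by polarization, so equivalence of
  -- forms yields an equality of matrices.
  have key : ∀ P : Matrix n n ℂ, P.IsSymm →
      QuadraticMap.associated (R := ℂ) (LinearMap.BilinMap.toQuadraticMap
        (Matrix.toLinearMap₂' ℂ P)) = Matrix.toLinearMap₂' ℂ P := by
    intro P hP
    refine QuadraticMap.associated_left_inverse ℂ ?_
    intro x y
    simp only [Matrix.toLinearMap₂'_apply']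
    rw [Matrix.dotProduct_mulVec, ← Matrix.mulVec_transpose, hP.eq, dotProduct_comm]
  obtain ⟨e⟩ := QuadraticForm.equivalent_of_isAlgClosed
    (LinearMap.BilinMap.toQuadraticMap (Matrix.toLinearMap₂' ℂ P))
    (LinearMap.BilinMap.toQuadraticMap (Matrix.toLinearMap₂' ℂ (1 : Matrix n n ℂ)))
    (by rw [key P hP]; exact LinearMap.separatingLeft_toLinearMap₂'_iff_det_ne_zero.2 hdet)
    (by
      rw [key 1 Matrix.isSymm_one]
      exact LinearMap.separatingLeft_toLinearMap₂'_iff_det_ne_zero.2 (by simp))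
  let f : (n → ℂ) →ₗ[ℂ] (n → ℂ) := e.toLinearEquiv.toLinearMap
  refine ⟨LinearMap.toMatrix' f, ?_⟩
  have hM : ((LinearMap.toMatrix' f)ᵀ * LinearMap.toMatrix' f).IsSymm :=
    Matrix.isSymm_transpose_mul_self _
  suffices (Matrix.toLinearMap₂' ℂ ((LinearMap.toMatrix' f)ᵀ * LinearMap.toMatrix' f) :
      (n → ℂ) →ₗ[ℂ] (n → ℂ) →ₗ[ℂ] ℂ) = Matrix.toLinearMap₂' ℂ P from LinearEquiv.injective _ this
  rw [← key _ hM, ← key _ hP]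
  congr 1
  ext x
  have h := e.map_app x
  simp only [LinearMap.BilinMap.toQuadraticMap_apply, Matrix.toLinearMap₂'_apply',
    Matrix.one_mulVec] at h ⊢
  rw [← h, ← Matrix.mulVec_mulVec, Matrix.dotProduct_mulVec, ← Matrix.mulVec_transpose,
    Matrix.transpose_transpose]
  have hf : LinearMap.toMatrix' f *ᵥ x = e x := LinearMap.toMatrix'_mulVec f x
  rw [hf]

/-- Two families of vectors, the first spanning and the second separating points, whose mutual
dot products are symmetric, are related by an invertible symmetric matrix. -/
theorem Matrix.exists_isSymm_mulVec_eq {ι n : Type*} [Fintype n] [DecidableEq n]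
    (r o : ι → n → ℂ) (hr : Submodule.span ℂ (Set.range r) = ⊤)
    (ho : ∀ x : n → ℂ, (∀ i, o i ⬝ᵥ x = 0) → x = 0)
    (hsymm : ∀ i j, o i ⬝ᵥ r j = o j ⬝ᵥ r i) :
    ∃ P : Matrix n n ℂ, P.IsSymm ∧ P.det ≠ 0 ∧ ∀ i, P *ᵥ r i = o i := by
  let Lr : (ι →₀ ℂ) →ₗ[ℂ] (n → ℂ) := Finsupp.linearCombination ℂ r
  let Lo : (ι →₀ ℂ) →ₗ[ℂ] (n → ℂ) := Finsupp.linearCombination ℂ o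
  have hLr : LinearMap.range Lr = ⊤ := by rw [Finsupp.range_linearCombination, hr]
  have hpair : ∀ x j, Lo x ⬝ᵥ r j = o j ⬝ᵥ Lr x := by
    intro x j
    induction x using Finsupp.induction_linear with
    | zero => simp
    | add x y hx hy => simp only [map_add, add_dotProduct, dotProduct_add, hx, hy]
    | single i c => simp [Lo, Lr, hsymm i j]
  have hsep : ∀ y : n → ℂ, (∀ j, y ⬝ᵥ r j = 0) → y = 0 := by
    intro y hy
    refine dotProduct_eq_zero y fun w => ?_
    have hw : w ∈ Submodule.span ℂ (Set.range r) := hr ▸ Submodule.mem_top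
    induction hw using Submodule.span_induction with
    | mem x hx => obtain ⟨j, rfl⟩ := hx; exact hy j
    | zero => simp
    | add a b _ _ ha hb => rw [dotProduct_add, ha, hb, add_zero]
    | smul c a _ ha => rw [dotProduct_smul, ha, smul_zero]
  -- `hpair` and `hsep` give `ker Lr ≤ ker Lo`, so `Lo` composed with any section of `Lr` sends `r
  -- i` to `o i`.
  obtain ⟨s, hs⟩ := Lr.exists_rightInverse_of_surjective hLr
  let f : (n → ℂ) →ₗ[ℂ] (n → ℂ) := Lo ∘ₗ s
  have hf : ∀ i, f (r i) = o i := by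
    intro i
    have h1 : Lr (s (r i) - Finsupp.single i 1) = 0 := by
      have := LinearMap.congr_fun hs (r i)
      simp only [LinearMap.comp_apply, LinearMap.id_apply] at this
      rw [map_sub, this]
      simp [Lr]
    have h2 : Lo (s (r i) - Finsupp.single i 1) = 0 :=
      hsep _ fun j => by rw [hpair, h1, dotProduct_zero]
    rw [map_sub, sub_eq_zero] at h2
    simpa [Lo, f] using h2
  have hP : ∀ i, LinearMap.toMatrix' f *ᵥ r i = o i := fun i => by
    rw [LinearMap.toMatrix'_mulVec, hf]
  have hPs : (LinearMap.toMatrix' f).IsSymm := by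
    have h : ∀ i, (LinearMap.toMatrix' f)ᵀ *ᵥ r i = o i := by
      intro i
      rw [← sub_eq_zero]
      refine hsep _ fun j => ?_
      rw [sub_dotProduct, Matrix.mulVec_transpose, ← Matrix.dotProduct_mulVec, hP, dotProduct_comm,
        hsymm, sub_self]
    refine Matrix.toLin'.injective (LinearMap.ext_on hr ?_)
    rintro _ ⟨i, rfl⟩
    rw [Matrix.toLin'_apply, Matrix.toLin'_apply, h, hP]
  refine ⟨LinearMap.toMatrix' f, hPs, ?_, hP⟩
  intro hdet
  obtain ⟨x, hx, hx0⟩ := Matrix.exists_mulVec_eq_zero_iff.2 hdet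
  refine hx (ho x fun i => ?_)
  rw [← hP i, ← hPs.eq, Matrix.mulVec_transpose, ← Matrix.dotProduct_mulVec, hx0, dotProduct_zero]

/-! ### Resolvents near infinity -/

open Filter in
theorem Matrix.eventually_det_smul_one_sub_ne_zero {n : Type*} [Fintype n] [DecidableEq n]
    (A : Matrix n n ℂ) :
    ∀ᶠ s : ℂ in Bornology.cobounded ℂ, (s • (1 : Matrix n n ℂ) - A).det ≠ 0 := by
  let _ : NormedRing (Matrix n n ℂ) := Matrix.linftyOpNormedRing
  let _ : NormedAlgebra ℂ (Matrix n n ℂ) := Matrix.linftyOpNormedAlgebra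
  have : CompleteSpace (Matrix n n ℂ) := FiniteDimensional.complete ℂ _
  filter_upwards [spectrum.eventually_isUnit_resolvent (𝕜 := ℂ) A] with s hs
  rw [← spectrum.isUnit_resolvent, spectrum.mem_resolventSet_iff,
    Algebra.algebraMap_eq_smul_one, Matrix.isUnit_iff_isUnit_det] at hs
  exact hs.ne_zero

open Filter in
theorem Matrix.tendsto_inv_smul_one_sub {n : Type*} [Fintype n] [DecidableEq n]
    (A : Matrix n n ℂ) :
    Tendsto (fun s : ℂ => (s • (1 : Matrix n n ℂ) - A)⁻¹) (Bornology.cobounded ℂ) (nhds 0) := by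
  let _ : NormedRing (Matrix n n ℂ) := Matrix.linftyOpNormedRing
  let _ : NormedAlgebra ℂ (Matrix n n ℂ) := Matrix.linftyOpNormedAlgebra
  have : CompleteSpace (Matrix n n ℂ) := FiniteDimensional.complete ℂ _
  refine (spectrum.resolvent_tendsto_cobounded A).congr fun s => ?_
  rw [resolvent, Matrix.nonsing_inv_eq_ringInverse, Algebra.algebraMap_eq_smul_one]

theorem Matrix.mul_mul_inv_smul_one_sub {n : Type*} [Fintype n] [DecidableEq n]
    (M : Matrix n n ℂ) {A : Matrix n n ℂ} {s : ℂ} (hdet : (s • (1 : Matrix n n ℂ) - A).det ≠ 0) :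
    M * A * (s • (1 : Matrix n n ℂ) - A)⁻¹ = s • (M * (s • (1 : Matrix n n ℂ) - A)⁻¹) - M := by
  have h := Matrix.mul_nonsing_inv (s • (1 : Matrix n n ℂ) - A) (Ne.isUnit hdet)
  have h' : A * (s • (1 : Matrix n n ℂ) - A)⁻¹ = s • (s • (1 : Matrix n n ℂ) - A)⁻¹ - 1 := by
    rw [Matrix.sub_mul, Matrix.smul_mul, Matrix.one_mul] at h
    rw [eq_sub_iff_add_eq, ← sub_eq_iff_eq_add'.1 h]
  rw [Matrix.mul_assoc, h', Matrix.mul_sub, Matrix.mul_one, Matrix.mul_smul]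

open Filter in
/-- A trace functional that vanishes on the resolvent of `A` near infinity vanishes on all powers
of `A`. -/
theorem Matrix.trace_mul_pow_eq_zero_of_resolvent {n : Type*} [Fintype n] [DecidableEq n]
    (A M : Matrix n n ℂ)
    (h : ∀ᶠ s : ℂ in Bornology.cobounded ℂ,
      (M * (s • (1 : Matrix n n ℂ) - A)⁻¹).trace = 0) (k : ℕ) :
    (M * A ^ k).trace = 0 := by
  -- In `M A R(s) = s M R(s) - M`, with `R(s)` the resolvent, the left side tends to `0` while the
  -- right side has trace `-tr M`.
  have hzero : ∀ M : Matrix n n ℂ, (∀ᶠ s : ℂ in Bornology.cobounded ℂ,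
      (M * (s • (1 : Matrix n n ℂ) - A)⁻¹).trace = 0) → M.trace = 0 := by
    intro M h
    have hlim : Tendsto (fun s : ℂ => (M * A * (s • (1 : Matrix n n ℂ) - A)⁻¹).trace)
        (Bornology.cobounded ℂ) (nhds 0) := by
      have hcont : Continuous fun X : Matrix n n ℂ => (M * A * X).trace := by fun_prop
      simpa [Function.comp_def] using (hcont.tendsto 0).comp (Matrix.tendsto_inv_smul_one_sub A)
    have heq : ∀ᶠ s : ℂ in Bornology.cobounded ℂ,
        (M * A * (s • (1 : Matrix n n ℂ) - A)⁻¹).trace = -M.trace := by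
      filter_upwards [h, A.eventually_det_smul_one_sub_ne_zero] with s hs hdet
      rw [Matrix.mul_mul_inv_smul_one_sub M hdet, Matrix.trace_sub, Matrix.trace_smul, hs,
        smul_zero, zero_sub]
    have := tendsto_nhds_unique (hlim.congr' heq) tendsto_const_nhds
    simpa using this.symm
  induction k generalizing M with
  | zero => simpa using hzero M h
  | succ k ih =>
    rw [pow_succ', ← Matrix.mul_assoc]
    refine ih _ ?_
    filter_upwards [h, A.eventually_det_smul_one_sub_ne_zero] with s hs hdet
    rw [Matrix.mul_mul_inv_smul_one_sub M hdet, Matrix.trace_sub, Matrix.trace_smul, hs,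
      hzero M h, smul_zero, sub_zero]

/-! ### Bivectors of `ℂ⁴` and the Klein quadric -/

namespace ExteriorAlgebra

/-- The standard basis of `ℂ² ⊕ ℂ²`. -/
def stdVec (i : Fin 2 ⊕ Fin 2) : Fin 2 ⊕ Fin 2 → ℂ := Pi.single i 1

theorem eq_sum_stdVec (v : Fin 2 ⊕ Fin 2 → ℂ) :
    v = v (.inl 0) • stdVec (.inl 0) + v (.inl 1) • stdVec (.inl 1)
      + v (.inr 0) • stdVec (.inr 0) + v (.inr 1) • stdVec (.inr 1) := by
  ext i
  rcases i with i | i <;> fin_cases i <;> simp [stdVec]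

theorem ι_mul_ι_swap (u v : Fin 2 ⊕ Fin 2 → ℂ) : ι ℂ u * ι ℂ v = -(ι ℂ v * ι ℂ u) :=
  eq_neg_of_add_eq_zero_left (ι_add_mul_swap u v)

/-- The bivector with the given Plücker coordinates. -/
noncomputable def bivector (z₁₂ z₁₃ z₁₄ z₂₃ z₂₄ z₃₄ : ℂ) :
    ExteriorAlgebra ℂ (Fin 2 ⊕ Fin 2 → ℂ) :=
  z₁₂ • (ι ℂ (stdVec (.inl 0)) * ι ℂ (stdVec (.inl 1))) +
  z₁₃ • (ι ℂ (stdVec (.inl 0)) * ι ℂ (stdVec (.inr 0))) +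
  z₁₄ • (ι ℂ (stdVec (.inl 0)) * ι ℂ (stdVec (.inr 1))) +
  z₂₃ • (ι ℂ (stdVec (.inl 1)) * ι ℂ (stdVec (.inr 0))) +
  z₂₄ • (ι ℂ (stdVec (.inl 1)) * ι ℂ (stdVec (.inr 1))) +
  z₃₄ • (ι ℂ (stdVec (.inr 0)) * ι ℂ (stdVec (.inr 1)))

theorem ι_mul_ι_eq_bivector (u v : Fin 2 ⊕ Fin 2 → ℂ) :
    ι ℂ u * ι ℂ v = bivector
      (u (.inl 0) * v (.inl 1) - u (.inl 1) * v (.inl 0))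
      (u (.inl 0) * v (.inr 0) - u (.inr 0) * v (.inl 0))
      (u (.inl 0) * v (.inr 1) - u (.inr 1) * v (.inl 0))
      (u (.inl 1) * v (.inr 0) - u (.inr 0) * v (.inl 1))
      (u (.inl 1) * v (.inr 1) - u (.inr 1) * v (.inl 1))
      (u (.inr 0) * v (.inr 1) - u (.inr 1) * v (.inr 0)) := by
  conv_lhs => rw [eq_sum_stdVec u, eq_sum_stdVec v]
  simp only [map_add, map_smul, mul_add, add_mul, smul_mul_smul_comm, ι_sq_zero, smul_zero]
  rw [ι_mul_ι_swap (stdVec (.inl 1)) (stdVec (.inl 0)),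
    ι_mul_ι_swap (stdVec (.inr 0)) (stdVec (.inl 0)),
    ι_mul_ι_swap (stdVec (.inr 1)) (stdVec (.inl 0)),
    ι_mul_ι_swap (stdVec (.inr 0)) (stdVec (.inl 1)),
    ι_mul_ι_swap (stdVec (.inr 1)) (stdVec (.inl 1)),
    ι_mul_ι_swap (stdVec (.inr 1)) (stdVec (.inr 0)), bivector]
  module

theorem ιMulti_two (v : Fin 2 → (Fin 2 ⊕ Fin 2 → ℂ)) :
    ιMulti ℂ 2 v = ι ℂ (v 0) * ι ℂ (v 1) := by
  simp [ιMulti_apply, Matrix.vecTail]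

theorem exists_eq_bivector (z : ⋀[ℂ]^2 (Fin 2 ⊕ Fin 2 → ℂ)) :
    ∃ z₁₂ z₁₃ z₁₄ z₂₃ z₂₄ z₃₄ : ℂ,
      (z : ExteriorAlgebra ℂ (Fin 2 ⊕ Fin 2 → ℂ)) = bivector z₁₂ z₁₃ z₁₄ z₂₃ z₂₄ z₃₄ := by
  have hz : z ∈ Submodule.span ℂ
      (Set.range (exteriorPower.ιMulti ℂ 2 (M := Fin 2 ⊕ Fin 2 → ℂ))) := by
    rw [exteriorPower.ιMulti_span]; exact Submodule.mem_top
  induction hz using Submodule.span_induction with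
  | mem x hx =>
    obtain ⟨v, rfl⟩ := hx
    rw [exteriorPower.ιMulti_apply_coe, ιMulti_two, ι_mul_ι_eq_bivector]
    exact ⟨_, _, _, _, _, _, rfl⟩
  | zero => exact ⟨0, 0, 0, 0, 0, 0, by simp [bivector]⟩
  | add x y _ _ hx hy =>
    obtain ⟨a, b, c, d, e, f, hx⟩ := hx
    obtain ⟨a', b', c', d', e', f', hy⟩ := hy
    refine ⟨a + a', b + b', c + c', d + d', e + e', f + f', ?_⟩
    rw [Submodule.coe_add, hx, hy]
    simp only [bivector]
    module
  | smul r x _ hx =>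
    obtain ⟨a, b, c, d, e, f, hx⟩ := hx
    refine ⟨r * a, r * b, r * c, r * d, r * e, r * f, ?_⟩
    rw [Submodule.coe_smul, hx]
    simp only [bivector]
    module

/-- The determinant of four vectors of `ℂ² ⊕ ℂ²`. -/
noncomputable def volumeForm : (Fin 2 ⊕ Fin 2 → ℂ) [⋀^Fin 4]→ₗ[ℂ] ℂ :=
  Matrix.detRowAlternating.compLinearMap
    (LinearMap.funLeft ℂ ℂ (finSumFinEquiv (m := 2) (n := 2)).symm)

/-- The volume functional on `⋀⁴ (ℂ² ⊕ ℂ²)`. -/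
noncomputable def volume : ExteriorAlgebra ℂ (Fin 2 ⊕ Fin 2 → ℂ) →ₗ[ℂ] ℂ :=
  liftAlternating fun
    | 4 => volumeForm
    | _ => 0

theorem volume_ι_mul (a b c d : Fin 2 ⊕ Fin 2 → ℂ) :
    volume (ι ℂ a * ι ℂ b * (ι ℂ c * ι ℂ d)) =
      (Matrix.of fun i : Fin 4 => ![a, b, c, d] i ∘ (finSumFinEquiv (m := 2) (n := 2)).symm).det := by
  have : ι ℂ a * ι ℂ b * (ι ℂ c * ι ℂ d) = ιMulti ℂ 4 ![a, b, c, d] := by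
    simp [ιMulti_apply, mul_assoc]
  rw [this, volume, liftAlternating_apply_ιMulti]
  rfl

theorem volume_ι_mul_ι_mul_bivector (u v : Fin 2 ⊕ Fin 2 → ℂ) (z₁₂ z₁₃ z₁₄ z₂₃ z₂₄ z₃₄ : ℂ) :
    volume (ι ℂ u * ι ℂ v * bivector z₁₂ z₁₃ z₁₄ z₂₃ z₂₄ z₃₄) =
      (u (.inl 0) * v (.inl 1) - u (.inl 1) * v (.inl 0)) * z₃₄ -
      (u (.inl 0) * v (.inr 0) - u (.inr 0) * v (.inl 0)) * z₂₄ +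
      (u (.inl 0) * v (.inr 1) - u (.inr 1) * v (.inl 0)) * z₂₃ +
      (u (.inl 1) * v (.inr 0) - u (.inr 0) * v (.inl 1)) * z₁₄ -
      (u (.inl 1) * v (.inr 1) - u (.inr 1) * v (.inl 1)) * z₁₃ +
      (u (.inr 0) * v (.inr 1) - u (.inr 1) * v (.inr 0)) * z₁₂ := by
  have h0 : (finSumFinEquiv (m := 2) (n := 2)).symm 0 = .inl 0 := rfl
  have h1 : (finSumFinEquiv (m := 2) (n := 2)).symm 1 = .inl 1 := rfl
  have h2 : (finSumFinEquiv (m := 2) (n := 2)).symm 2 = .inr 0 := rfl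
  have h3 : (finSumFinEquiv (m := 2) (n := 2)).symm 3 = .inr 1 := rfl
  simp only [bivector, mul_add, mul_smul_comm, map_add, map_smul, volume_ι_mul]
  simp [Matrix.det_succ_row_zero, Fin.sum_univ_succ, stdVec, h0, h1, h2, h3, Fin.succAbove, Pi.single_apply]
  ring

/-- The nonzero bivectors on the Klein quadric with vanishing last coordinate are decomposable. -/
theorem exists_linearIndependent_bivector_eq {z₁₂ z₁₃ z₁₄ z₂₃ z₂₄ : ℂ}
    (hz : bivector z₁₂ z₁₃ z₁₄ z₂₃ z₂₄ 0 ≠ 0) (hq : z₁₃ * z₂₄ = z₁₄ * z₂₃) :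
    ∃ v : Fin 2 → (Fin 2 ⊕ Fin 2 → ℂ), LinearIndependent ℂ v ∧
      ιMulti ℂ 2 v = bivector z₁₂ z₁₃ z₁₄ z₂₃ z₂₄ 0 := by
  suffices ∃ u v : Fin 2 ⊕ Fin 2 → ℂ, ι ℂ u * ι ℂ v = bivector z₁₂ z₁₃ z₁₄ z₂₃ z₂₄ 0 by
    obtain ⟨u, v, h⟩ := this
    have h' : ιMulti ℂ 2 ![u, v] = bivector z₁₂ z₁₃ z₁₄ z₂₃ z₂₄ 0 := by rw [ιMulti_two, ← h]; rfl
    refine ⟨![u, v], ?_, h'⟩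
    by_contra hli
    exact hz (h' ▸ AlternatingMap.map_linearDependent _ _ hli)
  -- The quadric equation makes the matrix of `z₁₃, z₁₄, z₂₃, z₂₄` of rank at most one, a column
  -- `(a, b)` times a row `(c, d)`; `t₁, t₂` then adjust `z₁₂`.
  have key : ∀ a b c d t₁ t₂ : ℂ, a * t₂ - b * t₁ = z₁₂ → a * c = z₁₃ → a * d = z₁₄ →
      b * c = z₂₃ → b * d = z₂₄ →
      ∃ u v : Fin 2 ⊕ Fin 2 → ℂ, ι ℂ u * ι ℂ v = bivector z₁₂ z₁₃ z₁₄ z₂₃ z₂₄ 0 := by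
    intro a b c d t₁ t₂ h1 h2 h3 h4 h5
    refine ⟨Sum.elim ![a, b] 0, Sum.elim ![t₁, t₂] ![c, d], ?_⟩
    rw [ι_mul_ι_eq_bivector]
    simp [h1, h2, h3, h4, h5]
  by_cases h13 : z₁₃ = 0
  · by_cases h14 : z₁₄ = 0
    · by_cases h23 : z₂₃ = 0
      · by_cases h24 : z₂₄ = 0
        · exact key 1 0 0 0 0 z₁₂ (by simp) (by simp [h13]) (by simp [h14]) (by simp [h23])
            (by simp [h24])
        · exact key 0 1 z₂₃ z₂₄ (-z₁₂) 0 (by simp) (by simp [h13]) (by simp [h14]) (by simp)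
            (by simp)
      · exact key 0 1 z₂₃ z₂₄ (-z₁₂) 0 (by simp) (by simp [h13]) (by simp [h14]) (by simp)
            (by simp)
    · refine key 1 (z₂₄ / z₁₄) z₁₃ z₁₄ 0 z₁₂ (by simp) (by simp) (by simp) ?_ ?_
      · field_simp; linear_combination hq
      · field_simp
  · refine key 1 (z₂₃ / z₁₃) z₁₃ z₁₄ 0 z₁₂ (by simp) (by simp) (by simp) ?_ ?_
    · field_simp
    · field_simp; linear_combination -hq

end ExteriorAlgebra

/-! ### The relation on the transfer function, and output feedback -/

namespace StateSpaceRealization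

variable {N m p : ℕ}

-- The Plücker coordinates of `(I; G)` are `1`, the entries of `G` up to sign, and `det G`.
open ExteriorAlgebra in
theorem volume_pluckerGraph_mul_bivector (G : Matrix (Fin 2) (Fin 2) ℂ)
    (z₁₂ z₁₃ z₁₄ z₂₃ z₂₄ z₃₄ : ℂ) :
    volume ((pluckerGraph G : ExteriorAlgebra ℂ (Fin 2 ⊕ Fin 2 → ℂ)) *
      bivector z₁₂ z₁₃ z₁₄ z₂₃ z₂₄ z₃₄) =
      z₃₄ + (!![-z₁₄, z₁₃; -z₂₄, z₂₃] * G).trace + z₁₂ * G.det := by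
  rw [pluckerGraph, exteriorPower.ιMulti_apply_coe, ιMulti_two, volume_ι_mul_ι_mul_bivector]
  simp only [Matrix.trace_fin_two, Matrix.mul_apply, Fin.sum_univ_two, Matrix.det_fin_two]
  simp
  ring

open ExteriorAlgebra in
/-- If the pole placement map is proper, the transfer function satisfies a nondegenerate
affine-quadratic relation. -/
theorem ProperPolePlacement.exists_trace_relation {S : StateSpaceRealization N 2 2}
    (h : S.ProperPolePlacement) :
    ∃ (L : Matrix (Fin 2) (Fin 2) ℂ) (a : ℂ), L.det ≠ 0 ∧ ∀ s, ¬ S.IsEigenvalue s →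
      (L * S.transferFunction s).trace + a * (S.transferFunction s).det = 0 := by
  obtain ⟨z, hz, hz0⟩ := Submodule.exists_mem_ne_zero_of_ne_bot h.1
  obtain ⟨z₁₂, z₁₃, z₁₄, z₂₃, z₂₄, z₃₄, hzb⟩ := exists_eq_bivector z
  have hvol : ∀ G, pluckerGraph G ∈ S.curveSpan →
      z₃₄ + (!![-z₁₄, z₁₃; -z₂₄, z₂₃] * G).trace + z₁₂ * G.det = 0 := by
    intro G hG
    have hG' := hz _ hG
    rw [hzb] at hG'
    rw [← volume_pluckerGraph_mul_bivector, hG', map_zero]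
  have h34 : z₃₄ = 0 := by
    simpa using hvol 0 (Submodule.subset_span (Set.mem_insert _ _))
  subst h34
  refine ⟨!![-z₁₄, z₁₃; -z₂₄, z₂₃], z₁₂, ?_, fun s hs => ?_⟩
  -- With `z₃₄ = 0`, vanishing of `det L` is the Plücker relation, which would put `z` on the
  -- Grassmannian.
  · intro hdet
    rw [Matrix.det_fin_two_of] at hdet
    have hb : bivector z₁₂ z₁₃ z₁₄ z₂₃ z₂₄ 0 ≠ 0 := fun h0 => hz0 (Subtype.ext (hzb.trans h0))
    obtain ⟨v, hv, hvz⟩ := exists_linearIndependent_bivector_eq hb (by linear_combination hdet)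
    refine h.2 v hv ?_
    have : exteriorPower.ιMulti ℂ 2 v = z := Subtype.ext (by
      rw [exteriorPower.ιMulti_apply_coe, hvz, hzb])
    rw [this]
    exact hz
  · have := hvol _ (Submodule.subset_span (Set.mem_insert_of_mem _ ⟨s, hs, rfl⟩))
    simpa using this

theorem eventually_not_isEigenvalue (S : StateSpaceRealization N m p) :
    ∀ᶠ s : ℂ in Bornology.cobounded ℂ, ¬ S.IsEigenvalue s :=
  S.A.eventually_det_smul_one_sub_ne_zero

/-- The closed loop system obtained by the output feedback `u = K y + u'`. -/
def outputFeedback (S : StateSpaceRealization N m p) (K : Matrix (Fin m) (Fin p) ℂ) :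
    StateSpaceRealization N m p :=
  ⟨S.A + S.B * K * S.C, S.B, S.C⟩

/-- This is the resolvent identity `Y - Y (B K C) X = X` between `C` and `B`. -/
theorem transferFunction_outputFeedback_mul (S : StateSpaceRealization N m p)
    (K : Matrix (Fin m) (Fin p) ℂ) {s : ℂ} (hs : ¬ S.IsEigenvalue s)
    (hs' : ¬ (S.outputFeedback K).IsEigenvalue s) :
    (S.outputFeedback K).transferFunction s * (1 - K * S.transferFunction s) =
      S.transferFunction s := by
  have h1 := Matrix.mul_nonsing_inv _ (Ne.isUnit hs)
  have h2 := Matrix.nonsing_inv_mul _ (Ne.isUnit hs')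
  simp only [transferFunction]
  simp only [outputFeedback] at h2 ⊢
  set X := (s • (1 : Matrix (Fin N) (Fin N) ℂ) - S.A)⁻¹
  set Y := (s • (1 : Matrix (Fin N) (Fin N) ℂ) - (S.A + S.B * K * S.C))⁻¹
  have h3 : Y - Y * (S.B * K * S.C) * X = X := by
    calc Y - Y * (S.B * K * S.C) * X
        = Y * ((s • (1 : Matrix (Fin N) (Fin N) ℂ) - S.A) * X) - Y * (S.B * K * S.C) * X := by
          rw [h1, Matrix.mul_one]
      _ = Y * (s • (1 : Matrix (Fin N) (Fin N) ℂ) - (S.A + S.B * K * S.C)) * X := by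
          noncomm_ring
      _ = X := by rw [h2, Matrix.one_mul]
  calc S.C * Y * S.B * (1 - K * (S.C * X * S.B))
      = S.C * (Y - Y * (S.B * K * S.C) * X) * S.B := by
        simp only [Matrix.mul_sub, Matrix.sub_mul, Matrix.mul_one, Matrix.mul_assoc]
    _ = S.C * X * S.B := by rw [h3]

theorem one_add_mul_transferFunction_mul (S : StateSpaceRealization N m p)
    (K : Matrix (Fin m) (Fin p) ℂ) {s : ℂ} (hs : ¬ S.IsEigenvalue s)
    (hs' : ¬ (S.outputFeedback K).IsEigenvalue s) :
    (1 + K * (S.outputFeedback K).transferFunction s) * (1 - K * S.transferFunction s) = 1 := by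
  rw [Matrix.add_mul, Matrix.mul_assoc, S.transferFunction_outputFeedback_mul K hs hs']
  simp

/-- Output feedback removes the quadratic term from an affine-quadratic relation. -/
theorem trace_mul_feedback_eq_zero {L G G' : Matrix (Fin 2) (Fin 2) ℂ} {a : ℂ} (hL : L.det ≠ 0)
    (hG : (L * G).trace + a * G.det = 0)
    (h : G' * (1 - (-(a / (2 * L.det)) • L) * G) = G)
    (h' : (1 + (-(a / (2 * L.det)) • L) * G') * (1 - (-(a / (2 * L.det)) • L) * G) = 1) :
    (L * G').trace = 0 := by
  set K := -(a / (2 * L.det)) • L with hK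
  have hdet : (1 - K * G).det ≠ 0 := by
    intro h0
    have := congrArg Matrix.det h'
    rw [Matrix.det_mul, h0, mul_zero, Matrix.det_one] at this
    exact zero_ne_one this
  -- For `2 × 2` matrices the adjugate is additive, so `G adj (1 - K G) = G - det G • adj K`.
  have h1 : (1 - K * G).det • G' = G - G.det • K.adjugate := by
    calc (1 - K * G).det • G' = G' * (1 - K * G) * (1 - K * G).adjugate := by
          rw [Matrix.mul_assoc, Matrix.mul_adjugate, Matrix.mul_smul, Matrix.mul_one]
      _ = G * (1 - K * G).adjugate := by rw [h]
      _ = G - G.det • K.adjugate := by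
          ext i j
          fin_cases i <;> fin_cases j <;>
          simp [Matrix.adjugate_fin_two, Matrix.mul_apply, Fin.sum_univ_two,
            Matrix.det_fin_two] <;> ring
  -- Since `L adj L = det L • 1` has trace `2 det L`, the scalar in `K` gives `tr (L adj K) = -a`,
  -- and the hypothesis `hG` appears.
  have h2 : (1 - K * G).det * (L * G').trace = 0 := by
    rw [← smul_eq_mul, ← Matrix.trace_smul, ← Matrix.mul_smul, h1, Matrix.mul_sub,
      Matrix.trace_sub, Matrix.mul_smul, hK, Matrix.adjugate_smul, Matrix.mul_smul,
      Matrix.mul_adjugate]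
    simp only [Fintype.card_fin, Matrix.trace_smul, Matrix.trace_one, smul_eq_mul]
    push_cast
    linear_combination hG + G.det * a * mul_inv_cancel₀ hL
  exact (mul_eq_zero.1 h2).resolve_left hdet

/-! ### Controllability and observability under feedback -/

theorem Controllable.eq_top_of_invariant {S : StateSpaceRealization N m p} (h : S.Controllable)
    (V : Submodule ℂ (Fin N → ℂ)) (hB : ∀ u, S.B *ᵥ u ∈ V) (hA : ∀ x ∈ V, S.A *ᵥ x ∈ V) :
    V = ⊤ := by
  rw [eq_top_iff, ← h]
  refine iSup_le fun k => ?_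
  rintro _ ⟨u, rfl⟩
  rw [Matrix.mulVecLin_apply]
  generalize (k : ℕ) = l
  induction l with
  | zero => simpa using hB u
  | succ l ih =>
    rw [pow_succ', Matrix.mul_assoc, ← Matrix.mulVec_mulVec]
    exact hA _ ih

/-- Feedback changes `A x` only by a vector in the range of `B`, so subspaces containing that range
stay invariant. Allowing all powers avoids Cayley–Hamilton. -/
theorem Controllable.span_outputFeedback {S : StateSpaceRealization N m p} (h : S.Controllable)
    (K : Matrix (Fin m) (Fin p) ℂ) :
    Submodule.span ℂ (Set.range fun i : ℕ × Fin m =>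
      ((S.outputFeedback K).A ^ i.1 * S.B).col i.2) = ⊤ := by
  set V := Submodule.span ℂ (Set.range fun i : ℕ × Fin m =>
      ((S.outputFeedback K).A ^ i.1 * S.B).col i.2) with hV
  have hmem : ∀ l j, ((S.outputFeedback K).A ^ l * S.B).col j ∈ V := fun l j =>
    Submodule.subset_span ⟨(l, j), rfl⟩
  have hB : ∀ u, S.B *ᵥ u ∈ V := by
    intro u
    rw [Matrix.mulVec_eq_sum]
    refine Submodule.sum_mem _ fun j _ => ?_
    have := hmem 0 j
    rw [pow_zero, Matrix.one_mul] at this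
    rw [op_smul_eq_smul]
    exact V.smul_mem (u j) this
  have hA' : ∀ x ∈ V, (S.outputFeedback K).A *ᵥ x ∈ V := by
    intro x hx
    induction hx using Submodule.span_induction with
    | mem x hx =>
      obtain ⟨⟨l, j⟩, rfl⟩ := hx
      have := hmem (l + 1) j
      rwa [pow_succ', Matrix.mul_assoc] at this
    | zero => rw [Matrix.mulVec_zero]; exact V.zero_mem
    | add x y _ _ hx hy => rw [Matrix.mulVec_add]; exact V.add_mem hx hy
    | smul c x _ hx => rw [Matrix.mulVec_smul]; exact V.smul_mem c hx
  refine h.eq_top_of_invariant V hB fun x hx => ?_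
  have h1 : S.A *ᵥ x = (S.outputFeedback K).A *ᵥ x - S.B *ᵥ (K *ᵥ (S.C *ᵥ x)) := by
    simp [outputFeedback, Matrix.add_mulVec, Matrix.mul_assoc]
  rw [h1]
  exact V.sub_mem (hA' x hx) (hB _)

/-- The feedback term sees a state only through `C`, so on an unobservable state the open and closed
loop powers agree. -/
theorem Observable.eq_zero_of_outputFeedback {S : StateSpaceRealization N m p} (h : S.Observable)
    (K : Matrix (Fin m) (Fin p) ℂ) {x : Fin N → ℂ}
    (hx : ∀ k : ℕ, (S.C * (S.outputFeedback K).A ^ k) *ᵥ x = 0) : x = 0 := by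
  have hpow : ∀ k : ℕ, S.A ^ k *ᵥ x = (S.outputFeedback K).A ^ k *ᵥ x := by
    intro k
    induction k with
    | zero => simp
    | succ k ih =>
      have hk := hx k
      rw [← Matrix.mulVec_mulVec] at hk
      rw [pow_succ', pow_succ', ← Matrix.mulVec_mulVec, ← Matrix.mulVec_mulVec, ih]
      simp only [outputFeedback] at hk ⊢
      rw [Matrix.add_mulVec, ← Matrix.mulVec_mulVec _ (S.B * K), hk, Matrix.mulVec_zero, add_zero]
  have hmem : x ∈ ⨅ k : Fin N, LinearMap.ker (S.C * S.A ^ (k : ℕ)).mulVecLin := by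
    simp only [Submodule.mem_iInf, LinearMap.mem_ker, Matrix.mulVecLin_apply]
    intro k
    rw [← Matrix.mulVec_mulVec, hpow, Matrix.mulVec_mulVec, hx]
  rw [h] at hmem
  simpa using hmem

/-! ### Symmetric realizations -/

/-- A realization with reachable and distinguishable states whose Markov parameters are symmetric
is similar to a symmetric realization. -/
theorem exists_symmetric_similarity {S : StateSpaceRealization N m m}
    (hc : Submodule.span ℂ (Set.range fun i : ℕ × Fin m => (S.A ^ i.1 * S.B).col i.2) = ⊤)
    (ho : ∀ x : Fin N → ℂ, (∀ k : ℕ, (S.C * S.A ^ k) *ᵥ x = 0) → x = 0)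
    (hs : ∀ k : ℕ, (S.C * S.A ^ k * S.B).IsSymm) :
    ∃ M : GL (Fin N) ℂ,
      (M.val * S.A * (M⁻¹).val)ᵀ = M.val * S.A * (M⁻¹).val ∧
        S.C * (M⁻¹).val = (M.val * S.B)ᵀ := by
  -- Hankel structure: only the sum of the two exponents matters.
  have hdot : ∀ i j : ℕ × Fin m, (S.C * S.A ^ i.1).row i.2 ⬝ᵥ (S.A ^ j.1 * S.B).col j.2 =
      (S.C * S.A ^ (i.1 + j.1) * S.B) i.2 j.2 := by
    intro i j
    rw [pow_add, ← Matrix.mul_assoc, Matrix.mul_assoc (S.C * S.A ^ i.1)]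
    rfl
  obtain ⟨P, hPs, hPdet, hP⟩ := Matrix.exists_isSymm_mulVec_eq
    (fun i : ℕ × Fin m => (S.A ^ i.1 * S.B).col i.2)
    (fun i : ℕ × Fin m => (S.C * S.A ^ i.1).row i.2) hc
    (fun x hx => ho x fun k => funext fun j => hx (k, j))
    (fun i j => by rw [hdot, hdot, add_comm, (hs _).apply])
  have hPB : ∀ k, P * (S.A ^ k * S.B) = (S.C * S.A ^ k)ᵀ := by
    intro k
    ext i j
    exact congrFun (hP (k, j)) i
  -- On the spanning columns of `A ^ k B`, both sides give `(C A ^ (k + 1))ᵀ`.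
  have hPA : P * S.A = S.Aᵀ * P := by
    refine Matrix.toLin'.injective (LinearMap.ext_on hc ?_)
    rintro _ ⟨⟨k, j⟩, rfl⟩
    simp only [Matrix.toLin'_apply]
    have h1 : P * S.A * (S.A ^ k * S.B) = S.Aᵀ * P * (S.A ^ k * S.B) := by
      rw [Matrix.mul_assoc, ← Matrix.mul_assoc S.A, ← pow_succ', hPB, Matrix.mul_assoc, hPB,
        ← Matrix.transpose_mul, Matrix.mul_assoc, ← pow_succ]
    exact congrArg (fun X => X.col j) h1
  have hC : P * S.B = S.Cᵀ := by simpa using hPB 0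
  obtain ⟨M, hM⟩ := hPs.exists_transpose_mul_self hPdet
  have hMdet : IsUnit M.det := by
    refine Ne.isUnit fun h0 => hPdet ?_
    rw [← hM, Matrix.det_mul, h0, mul_zero]
  have h1 : M * M⁻¹ = 1 := Matrix.mul_nonsing_inv _ hMdet
  have h1' : (M⁻¹)ᵀ * Mᵀ = 1 := by rw [← Matrix.transpose_mul, h1, Matrix.transpose_one]
  refine ⟨⟨M, M⁻¹, h1, Matrix.nonsing_inv_mul _ hMdet⟩, ?_, ?_⟩
  · change (M * S.A * M⁻¹)ᵀ = M * S.A * M⁻¹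
    calc (M * S.A * M⁻¹)ᵀ = (M⁻¹)ᵀ * (S.Aᵀ * (Mᵀ * M)) * M⁻¹ := by
          simp only [Matrix.transpose_mul, Matrix.mul_assoc, h1, Matrix.mul_one]
      _ = (M⁻¹)ᵀ * Mᵀ * (M * S.A * M⁻¹) := by
          rw [hM, ← hPA, ← hM]; simp only [Matrix.mul_assoc]
      _ = M * S.A * M⁻¹ := by rw [h1', Matrix.one_mul]
  · change S.C * M⁻¹ = (M * S.B)ᵀ
    rw [← Matrix.transpose_transpose S.C, ← hC, ← hM]
    simp only [Matrix.transpose_mul, Matrix.mul_assoc, Matrix.transpose_transpose, h1,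
      Matrix.mul_one]

theorem isSymm_of_trace_mul_eq_zero {G : Matrix (Fin 2) (Fin 2) ℂ}
    (h : (!![0, 1; -1, 0] * G).trace = 0) : G.IsSymm := by
  simp only [Matrix.trace_fin_two, Matrix.mul_apply, Fin.sum_univ_two] at h
  simp at h
  ext i j
  fin_cases i <;> fin_cases j <;> simp [Matrix.transpose_apply] <;>
    first | linear_combination h | linear_combination -h

end StateSpaceRealization

open StateSpaceRealization in
theorem corollary2p3 {N₀ N : ℕ}
    (S₀ : StateSpaceRealization N₀ 2 2)
    (hc₀ : S₀.Controllable) (ho₀ : S₀.Observable)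
    (hproper : S₀.ProperPolePlacement)
    (S : StateSpaceRealization N 2 2)
    (hsys : S.SameSystem S₀)
    (hc : S.Controllable) (ho : S.Observable) :
    ∃ S' : StateSpaceRealization N 2 2,
      S'.IsSymmetric ∧ S.StateFeedbackEquivalent S' := by
  obtain ⟨L, a, hL, hrel⟩ := hproper.exists_trace_relation
  set K : Matrix (Fin 2) (Fin 2) ℂ := -(a / (2 * L.det)) • L
  have htr : ∀ᶠ s : ℂ in Bornology.cobounded ℂ,
      (L * (S.outputFeedback K).transferFunction s).trace = 0 := by
    filter_upwards [S₀.eventually_not_isEigenvalue, S.eventually_not_isEigenvalue,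
      (S.outputFeedback K).eventually_not_isEigenvalue] with s h0 h1 h2
    have hG := hrel s h0
    rw [← hsys s h1 h0] at hG
    exact trace_mul_feedback_eq_zero hL hG (S.transferFunction_outputFeedback_mul K h1 h2)
      (S.one_add_mul_transferFunction_mul K h1 h2)
  have hmarkov : ∀ k : ℕ, (L * (S.C * (S.outputFeedback K).A ^ k * S.B)).trace = 0 := by
    intro k
    have hcyc : ∀ X : Matrix (Fin N) (Fin N) ℂ,
        (S.B * L * S.C * X).trace = (L * (S.C * X * S.B)).trace := fun X => by
      rw [Matrix.mul_assoc, Matrix.mul_assoc, Matrix.trace_mul_comm]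
      simp only [Matrix.mul_assoc]
    rw [← hcyc]
    exact Matrix.trace_mul_pow_eq_zero_of_resolvent _ _
      (htr.mono fun s hs => (hcyc _).trans hs) k
  let J : Matrix (Fin 2) (Fin 2) ℂ := !![0, 1; -1, 0]
  have hJ : J.det = 1 := by simp [J, Matrix.det_fin_two]
  let U : GL (Fin 2) ℂ := Matrix.GeneralLinearGroup.mkOfDetNeZero L hL
  let V : GL (Fin 2) ℂ := Matrix.GeneralLinearGroup.mkOfDetNeZero J (by rw [hJ]; exact one_ne_zero)
  let T : GL (Fin 2) ℂ := U⁻¹ * V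
  let S₁ : StateSpaceRealization N 2 2 := ⟨(S.outputFeedback K).A, S.B, (T⁻¹).val * S.C⟩
  -- `T` is chosen so that the relation for `L` becomes the relation for `J`, i.e. symmetry, once
  -- outputs are multiplied by `T⁻¹`.
  have hT : J * (T⁻¹).val = L := by
    have : V * T⁻¹ = U := by simp [T]
    exact congrArg Units.val this
  obtain ⟨M, hM1, hM2⟩ := exists_symmetric_similarity (S := S₁) (hc.span_outputFeedback K)
    (fun x hx => ho.eq_zero_of_outputFeedback K fun k => by
      have h1 := congrArg (T.val *ᵥ ·) (hx k)
      simp only [S₁, Matrix.mulVec_mulVec, Matrix.mulVec_zero] at h1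
      rw [Matrix.mul_assoc, ← Matrix.mul_assoc, ← Units.val_mul, mul_inv_cancel, Units.val_one,
        Matrix.one_mul] at h1
      exact h1)
    (fun k => isSymm_of_trace_mul_eq_zero (by
      have := hmarkov k
      rw [← hT] at this
      simpa only [S₁, J, Matrix.mul_assoc] using this))
  -- Taking `Q = K T` makes `Q T⁻¹ = K`, the feedback already applied.
  refine ⟨⟨M.val * S₁.A * (M⁻¹).val, M.val * S₁.B, S₁.C * (M⁻¹).val⟩, ⟨hM1, hM2⟩,
    M⁻¹, 1, T, K * T.val, ?_, ?_, ?_⟩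
  · have : K * T.val * (T⁻¹).val = K := by
      rw [Matrix.mul_assoc, ← Units.val_mul, mul_inv_cancel, Units.val_one, Matrix.mul_one]
    simp only [S₁, outputFeedback, inv_inv, Matrix.mul_assoc S.B, this]
  · simp [S₁]
  · simp [S₁]
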